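/- Let $M_n(\mathbb C)$ be the algebra of $n\times n$ complex matrices with the Hilbert–Schmidt inner product $\langle A,B\rangle=\mathrm{Tr}\,A^*B$. A function $f:(0,\infty)\to(0,\infty)$ is called a standard matrix monotone function if $f(1)=1$, $x f(x^{-1})=f(x)$ for all $x>0$, and, for all positive definite matrices $X,Y$ of the same (arbitrary) size, $X\le Y$ implies $f(X)\le f(Y)$. For a positive definite $\rho\in M_n(\mathbb C)$ let $\Delta(\rho/\rho)$ be the positive operator $B\mapsto \rho B\rho^{-1}$ on the Hilbert space $M_n(\mathbb C)$, let $f(\Delta(\rho/\rho))$ be given by functional calculus, and for $A,B\in M_n(\mathbb C)$ put $$\mathrm{qCov}^f_\rho(A,B)=\langle A\rho^{1/2}, f(\Delta(\rho/\rho))(B\rho^{1/2})\rangle-(\mathrm{Tr}\,\rho A^*)(\mathrm{Tr}\,\rho B).$$ (The first term equals $\langle A,\mathbb J^f_\rho B\rangle$, where $\mathbb J^f_\rho X=f(\Delta(\rho/\rho))(X\rho)$.) Theorem. Let $f$ be a standard matrix monotone function and let $A\in M_n(\mathbb C)$ be self-adjoint. Then $\mathrm{qCov}^f_\rho(A,A)$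 is real for every positive definite $\rho\in M_n(\mathbb C)$, and $\rho\mapsto\mathrm{qCov}^f_\rho(A,A)$ is a concave function on the set of positive definite matrices of $M_n(\mathbb C)$ (in particular, on the invertible density matrices). -/

import Mathlib

open scoped MatrixOrder ComplexOrder

namespace QuasiEntropy

/-- The Hilbert–Schmidt inner product `⟨A, B⟩ = Tr A* B`. -/
noncomputable def hsInner {n : ℕ} (A B : Matrix (Fin n) (Fin n) ℂ) : ℂ :=
  (A.conjTranspose * B).trace

/-- The (relative) modular operator `Δ(ρ₁/ρ₂) : B ↦ ρ₁ B ρ₂⁻¹`. -/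
noncomputable def modularOp {n : ℕ} (ρ₁ ρ₂ : Matrix (Fin n) (Fin n) ℂ) :
    Matrix (Fin n) (Fin n) ℂ →ₗ[ℂ] Matrix (Fin n) (Fin n) ℂ :=
  LinearMap.mulLeft ℂ ρ₁ ∘ₗ LinearMap.mulRight ℂ ρ₂⁻¹

/-- The matrix of a linear map `T : Mₙ(ℂ) → Mₙ(ℂ)` in the basis of matrix units, which is
orthonormal for the Hilbert–Schmidt inner product. -/
noncomputable def opMatrix {n : ℕ}
    (T : Matrix (Fin n) (Fin n) ℂ →ₗ[ℂ] Matrix (Fin n) (Fin n) ℂ) :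
    Matrix (Fin n × Fin n) (Fin n × Fin n) ℂ :=
  LinearMap.toMatrix (Matrix.stdBasis ℂ (Fin n) (Fin n)) (Matrix.stdBasis ℂ (Fin n) (Fin n)) T

/-- Functional calculus `f(T)` of a linear map `T : Mₙ(ℂ) → Mₙ(ℂ)` that is self-adjoint for the
Hilbert–Schmidt inner product, computed in the orthonormal basis of matrix units. -/
noncomputable def opFun {n : ℕ} (f : ℝ → ℝ)
    (T : Matrix (Fin n) (Fin n) ℂ →ₗ[ℂ] Matrix (Fin n) (Fin n) ℂ) :
    Matrix (Fin n) (Fin n) ℂ →ₗ[ℂ] Matrix (Fin n) (Fin n) ℂ :=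
  Matrix.toLin (Matrix.stdBasis ℂ (Fin n) (Fin n)) (Matrix.stdBasis ℂ (Fin n) (Fin n))
    (cfc f (opMatrix T))

/-- The quasi-entropy `S^A_f(ρ₁‖ρ₂)`, polarized in its upper argument:
`⟨A ρ₂^{1/2}, f(Δ(ρ₁/ρ₂)) (B ρ₂^{1/2})⟩`. -/
noncomputable def quasiEntropy {n : ℕ} (f : ℝ → ℝ) (ρ₁ ρ₂ A B : Matrix (Fin n) (Fin n) ℂ) : ℂ :=
  hsInner (A * CFC.sqrt ρ₂) (opFun f (modularOp ρ₁ ρ₂) (B * CFC.sqrt ρ₂))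

/-- The generalized covariance
`qCov^f_ρ(A, B) = ⟨A ρ^{1/2}, f(Δ(ρ/ρ)) (B ρ^{1/2})⟩ - (Tr ρ A*) (Tr ρ B)`. -/
noncomputable def qCov {n : ℕ} (f : ℝ → ℝ) (ρ A B : Matrix (Fin n) (Fin n) ℂ) : ℂ :=
  quasiEntropy f ρ ρ A B - (ρ * A.conjTranspose).trace * (ρ * B).trace

/-- The operator `𝕁^f_ρ = f(L_ρ R_ρ⁻¹) R_ρ`. -/
noncomputable def opJ {n : ℕ} (f : ℝ → ℝ) (ρ : Matrix (Fin n) (Fin n) ℂ) :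
    Matrix (Fin n) (Fin n) ℂ →ₗ[ℂ] Matrix (Fin n) (Fin n) ℂ :=
  opFun f (modularOp ρ ρ) ∘ₗ LinearMap.mulRight ℂ ρ

/-- A function `f` on `(0, ∞)` is matrix monotone if `A ≤ B` implies `f(A) ≤ f(B)` for positive
definite complex matrices of every size. The values of `f` outside `(0, ∞)` play no role. -/
def IsMatrixMonotone (f : ℝ → ℝ) : Prop :=
  ∀ (m : ℕ) (A B : Matrix (Fin m) (Fin m) ℂ), A.PosDef → B.PosDef → A ≤ B → cfc f A ≤ cfc f B

/-- Standard matrix monotone functions `f : (0, ∞) → (0, ∞)`: matrix monotone, with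
`x f(x⁻¹) = f(x)` and `f(1) = 1`. -/
structure IsStandardMatrixMonotone (f : ℝ → ℝ) : Prop where
  pos : ∀ x : ℝ, 0 < x → 0 < f x
  monotone : IsMatrixMonotone f
  symm : ∀ x : ℝ, 0 < x → x * f x⁻¹ = f x
  map_one : f 1 = 1

lemma opMatrix_mul {n : ℕ} (S T : Matrix (Fin n) (Fin n) ℂ →ₗ[ℂ] Matrix (Fin n) (Fin n) ℂ) :
    opMatrix (S ∘ₗ T) = opMatrix S * opMatrix T :=
  LinearMap.toMatrix_comp _ _ _ S T

lemma opMatrix_modularOp_apply {n : ℕ} (ρ₁ ρ₂ : Matrix (Fin n) (Fin n) ℂ) (i j k l : Fin n) :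
    opMatrix (modularOp ρ₁ ρ₂) (i, j) (k, l) = ρ₁ i k * ρ₂⁻¹ l j := by
  rw [opMatrix, LinearMap.toMatrix_apply, Matrix.stdBasis_eq_single]
  simp [modularOp, Matrix.stdBasis, Matrix.mul_apply, Matrix.single_apply, Finset.sum_ite_eq,
    ite_and]

/-- The modular operator is self-adjoint, so that its functional calculus is the genuine one. -/
lemma isSelfAdjoint_opMatrix_modularOp {n : ℕ} {ρ₁ ρ₂ : Matrix (Fin n) (Fin n) ℂ}
    (h₁ : ρ₁.PosDef) (h₂ : ρ₂.PosDef) : IsSelfAdjoint (opMatrix (modularOp ρ₁ ρ₂)) := by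
  have e₂ := h₂.inv.isHermitian
  ext ⟨i, j⟩ ⟨k, l⟩
  rw [Matrix.star_apply, opMatrix_modularOp_apply, opMatrix_modularOp_apply, star_mul',
    h₁.isHermitian.apply, e₂.apply]

lemma opFun_modularOp_mul {n : ℕ} (f : ℝ → ℝ) {ρ : Matrix (Fin n) (Fin n) ℂ} (hρ : ρ.PosDef)
    (X C : Matrix (Fin n) (Fin n) ℂ) (hC : Commute C ρ) :
    opFun f (modularOp ρ ρ) (X * C) = opFun f (modularOp ρ ρ) X * C := by
  have hC' : C * ρ⁻¹ = ρ⁻¹ * C := by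
    have hu : IsUnit ρ.det := (Matrix.isUnit_iff_isUnit_det ρ).mp hρ.isUnit
    calc C * ρ⁻¹ = ρ⁻¹ * (ρ * C) * ρ⁻¹ := by
          rw [← Matrix.mul_assoc, Matrix.nonsing_inv_mul _ hu, Matrix.one_mul]
      _ = ρ⁻¹ * C := by
          rw [← hC.eq, Matrix.mul_assoc, Matrix.mul_assoc, Matrix.mul_nonsing_inv _ hu,
            Matrix.mul_one]
  have h0 : modularOp ρ ρ ∘ₗ LinearMap.mulRight ℂ C = LinearMap.mulRight ℂ C ∘ₗ modularOp ρ ρ := by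
    ext1 Y
    simp [modularOp, Matrix.mul_assoc, hC']
  have h1 : Commute (opMatrix (modularOp ρ ρ)) (opMatrix (LinearMap.mulRight ℂ C)) := by
    rw [Commute, SemiconjBy, ← opMatrix_mul, ← opMatrix_mul, h0]
  have h2 := (isSelfAdjoint_opMatrix_modularOp hρ hρ).commute_cfc h1 f
  have h3 : opFun f (modularOp ρ ρ) ∘ₗ LinearMap.mulRight ℂ C
      = LinearMap.mulRight ℂ C ∘ₗ opFun f (modularOp ρ ρ) := by
    have hR : LinearMap.mulRight ℂ C = Matrix.toLin (Matrix.stdBasis ℂ (Fin n) (Fin n))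
        (Matrix.stdBasis ℂ (Fin n) (Fin n)) (opMatrix (LinearMap.mulRight ℂ C)) := by
      simp [opMatrix]
    rw [hR, opFun, ← Matrix.toLin_mul, ← Matrix.toLin_mul, h2.eq]
  simpa using LinearMap.congr_fun h3 X

/-- For positive definite `ρ`, `qCov^f_ρ(A, B) = ⟨A, 𝕁^f_ρ B⟩ - (Tr ρ A*) (Tr ρ B)`. -/
theorem qCov_eq_opJ {n : ℕ} (f : ℝ → ℝ) {ρ : Matrix (Fin n) (Fin n) ℂ} (hρ : ρ.PosDef)
    (A B : Matrix (Fin n) (Fin n) ℂ) :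
    qCov f ρ A B = hsInner A (opJ f ρ B) - (ρ * A.conjTranspose).trace * (ρ * B).trace := by
  have hs : CFC.sqrt ρ * CFC.sqrt ρ = ρ := CFC.sqrt_mul_sqrt_self ρ hρ.posSemidef.nonneg
  have hc : Commute (CFC.sqrt ρ) ρ := by
    have : Commute (CFC.sqrt ρ) (CFC.sqrt ρ * CFC.sqrt ρ) :=
      (Commute.refl _).mul_right (Commute.refl _)
    rwa [hs] at this
  have hh : (CFC.sqrt ρ).conjTranspose = CFC.sqrt ρ := (CFC.sqrt_nonneg ρ).isSelfAdjoint
  rw [qCov, quasiEntropy, opFun_modularOp_mul f hρ B _ hc, opJ, LinearMap.comp_apply,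
    LinearMap.mulRight_apply, opFun_modularOp_mul f hρ B ρ (Commute.refl ρ), hsInner, hsInner,
    Matrix.conjTranspose_mul, hh, Matrix.mul_assoc, Matrix.trace_mul_comm]
  simp only [Matrix.mul_assoc, hs]

end QuasiEntropy

/-!
Let `V` be an isometry and `P = V V*`. The bound `X ≤ (1 + ε) P X P + (1 + ε⁻¹) (1 - P) X (1 - P)`
has a right-hand side that commutes with `P`, so monotonicity of `f` gives
`V* f(X) V ≤ f((1 + ε) V* X V)`. For block diagonal `X` this is Jensen's operator inequality up to
the factor `1 + ε`; its scalar case already forces `f((1 + ε) x) → f(x)` as `ε ↓ 0`, which removes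
the factor. By Jensen's inequality the perspective `R^{1/2} f(R^{-1/2} L R^{-1/2}) R^{1/2}` is
superadditive, hence jointly concave, being positively homogeneous. The quasi-entropy is a quadratic
form of the perspective of left multiplication by `ρ₁` and right multiplication by `ρ₂`, and what is
subtracted from it in `qCov` is the convex function `|Tr ρ A|²`.
-/

namespace QuasiEntropy

open Filter Matrix Polynomial Topology
open scoped Kronecker

section FunctionalCalculus

variable {𝕜 ι κ κ' : Type*} [RCLike 𝕜] [Fintype ι] [DecidableEq ι] [Fintype κ] [DecidableEq κ]
  [Fintype κ'] [DecidableEq κ']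

lemma exists_polynomial_eqOn {K : Type*} [Field K] (f : K → K) {s : Set K} (hs : s.Finite) :
    ∃ p : K[X], s.EqOn f p.eval := by
  classical
  refine ⟨Lagrange.interpolate hs.toFinset id f, fun x hx => ?_⟩
  exact (Lagrange.eval_interpolate_at_node f (Set.injOn_id _) (hs.mem_toFinset.mpr hx)).symm

lemma aeval_mul_eq_mul_aeval {R S : Type*} [CommSemiring R] [CommSemiring S] [Algebra R S]
    {Z : Matrix κ κ S} {Y : Matrix ι ι S} {V : Matrix κ ι S} (h : Z * V = V * Y) (p : R[X]) :
    aeval Z p * V = V * aeval Y p := by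
  have hpow : ∀ k : ℕ, Z ^ k * V = V * Y ^ k := by
    intro k
    induction k with
    | zero => simp
    | succ k ih =>
      rw [pow_succ, Matrix.mul_assoc, h, ← Matrix.mul_assoc, ih, Matrix.mul_assoc, ← pow_succ]
  rw [aeval_eq_sum_range, aeval_eq_sum_range, Matrix.sum_mul, Matrix.mul_sum]
  exact Finset.sum_congr rfl fun k _ => by rw [Matrix.smul_mul, hpow, Matrix.mul_smul]

lemma cfc_mul_eq_mul_cfc (f : ℝ → ℝ) {Z : Matrix κ κ 𝕜} {Y : Matrix ι ι 𝕜} {V : Matrix κ ι 𝕜}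
    (hZ : Z.IsHermitian) (hY : Y.IsHermitian) (h : Z * V = V * Y) :
    cfc f Z * V = V * cfc f Y := by
  obtain ⟨p, hp⟩ := exists_polynomial_eqOn f
    (Z.finite_real_spectrum.union Y.finite_real_spectrum)
  have hfZ : cfc f Z = aeval Z p :=
    (cfc_congr (hp.mono Set.subset_union_left)).trans (cfc_polynomial p Z hZ)
  have hfY : cfc f Y = aeval Y p :=
    (cfc_congr (hp.mono Set.subset_union_right)).trans (cfc_polynomial p Y hY)
  rw [hfZ, hfY, aeval_mul_eq_mul_aeval h]

lemma cfc_submatrix_equiv (f : ℝ → ℝ) {Z : Matrix κ κ 𝕜} (hZ : Z.IsHermitian) (e : ι ≃ κ) :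
    cfc f (Z.submatrix e e) = (cfc f Z).submatrix e e := by
  have hV : Z.submatrix e e * (1 : Matrix κ κ 𝕜).submatrix e id =
      (1 : Matrix κ κ 𝕜).submatrix e id * Z := by
    ext i j
    rw [Matrix.mul_apply, ← e.symm.sum_comp]
    simp [Matrix.mul_apply, Matrix.one_apply]
  have h := cfc_mul_eq_mul_cfc f (hZ.submatrix e) hZ hV
  ext i j
  simpa [Matrix.mul_apply, Matrix.one_apply] using congrFun₂ h i (e j)

lemma cfc_fromBlocks_diagonal (f : ℝ → ℝ) {X : Matrix κ κ 𝕜} {Y : Matrix κ' κ' 𝕜}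
    (hX : X.IsHermitian) (hY : Y.IsHermitian) :
    cfc f (fromBlocks X 0 0 Y) = fromBlocks (cfc f X) 0 0 (cfc f Y) := by
  have hXY : (fromBlocks X 0 0 Y).IsHermitian := hX.fromBlocks (by simp) hY
  have hleft := cfc_mul_eq_mul_cfc f (V := fromRows (1 : Matrix κ κ 𝕜) (0 : Matrix κ' κ 𝕜))
    hXY hX (by simp [fromBlocks_mul_fromRows, fromRows_mul])
  have hright := cfc_mul_eq_mul_cfc f (V := fromRows (0 : Matrix κ κ' 𝕜) (1 : Matrix κ' κ' 𝕜))
    hXY hY (by simp [fromBlocks_mul_fromRows, fromRows_mul])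
  rw [← fromBlocks_toBlocks (cfc f (fromBlocks X 0 0 Y))] at hleft hright ⊢
  simp only [fromBlocks_mul_fromRows, fromRows_mul, fromRows_inj.eq_iff, Matrix.mul_one,
    Matrix.mul_zero, Matrix.one_mul, Matrix.zero_mul, add_zero, zero_add] at hleft hright
  rw [hleft.1, hleft.2, hright.1, hright.2]

lemma tendsto_cfc_of_tendsto_on_spectrum {α : Type*} {l : Filter α} {F : α → ℝ → ℝ} {f : ℝ → ℝ}
    {Y : Matrix ι ι 𝕜} (h : ∀ x ∈ spectrum ℝ Y, Tendsto (F · x) l (𝓝 (f x))) :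
    Tendsto (fun i => cfc (F i) Y) l (𝓝 (cfc f Y)) := by
  refine tendsto_cfc_fun (Metric.tendstoUniformlyOn_iff.mpr fun δ hδ => ?_)
    (.of_forall fun i => Y.finite_real_spectrum.continuousOn _)
  refine (eventually_all_finite Y.finite_real_spectrum).mpr fun x hx => ?_
  simpa only [dist_comm] using Metric.tendsto_nhds.mp (h x hx) δ hδ

end FunctionalCalculus

section LoewnerOrder

variable {𝕜 ι κ κ' : Type*} [RCLike 𝕜]

lemma conjTranspose_mul_mul_mono [Finite ι] [Fintype κ] {X Y : Matrix κ κ 𝕜} (h : X ≤ Y)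
    (V : Matrix κ ι 𝕜) : Vᴴ * X * V ≤ Vᴴ * Y * V := by
  rw [Matrix.le_iff] at h ⊢
  simpa only [Matrix.mul_sub, Matrix.sub_mul] using h.conjTranspose_mul_mul_same V

lemma posDef_fromBlocks_diagonal [Finite κ] [Finite κ'] {X : Matrix κ κ 𝕜}
    {Y : Matrix κ' κ' 𝕜} (hX : X.PosDef) (hY : Y.PosDef) : (fromBlocks X 0 0 Y).PosDef := by
  classical
  have := Fintype.ofFinite κ
  have := Fintype.ofFinite κ'
  have := hX.isUnit.invertible
  have hpsd : (fromBlocks X 0 0 Y).PosSemidef := by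
    simpa using (PosDef.fromBlocks₁₁ (0 : Matrix κ κ' 𝕜) Y hX).mpr (by simpa using hY.posSemidef)
  rw [hpsd.posDef_iff_isUnit, Matrix.isUnit_iff_isUnit_det, det_fromBlocks_zero₂₁]
  exact ((isUnit_iff_isUnit_det X).mp hX.isUnit).mul ((isUnit_iff_isUnit_det Y).mp hY.isUnit)

lemma convex_posDef : Convex ℝ {X : Matrix κ κ 𝕜 | X.PosDef} :=
  convex_iff_forall_pos.mpr fun _ hX _ hY _ _ ha hb _ => (hX.smul ha).add (hY.smul hb)

lemma conjTranspose_add_mul_mul_add_le [Finite ι] [Fintype κ] {X : Matrix κ κ 𝕜}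
    (hX : X.PosSemidef) (P Q : Matrix κ ι 𝕜) {ε : ℝ} (hε : 0 < ε) :
    (P + Q)ᴴ * X * (P + Q) ≤ (1 + ε) • (Pᴴ * X * P) + (1 + ε⁻¹) • (Qᴴ * X * Q) := by
  have hsq : (1 + ε) • (Pᴴ * X * P) + (1 + ε⁻¹) • (Qᴴ * X * Q) - (P + Q)ᴴ * X * (P + Q) =
      ε⁻¹ • ((ε • P - Q)ᴴ * X * (ε • P - Q)) := by
    simp only [conjTranspose_add, conjTranspose_sub, conjTranspose_smul, star_trivial,
      Matrix.add_mul, Matrix.sub_mul, Matrix.mul_add, Matrix.mul_sub, Matrix.smul_mul,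
      Matrix.mul_smul, smul_sub, smul_smul, add_smul, one_smul, inv_mul_cancel₀ hε.ne',
      inv_mul_cancel_left₀ hε.ne']
    abel
  rw [Matrix.le_iff, hsq]
  exact (hX.conjTranspose_mul_mul_same _).smul (inv_nonneg.mpr hε.le)

end LoewnerOrder

section MatrixMonotone

variable {ι κ κ' : Type*} [Fintype ι] [DecidableEq ι] [Fintype κ] [DecidableEq κ]
  [Fintype κ'] [DecidableEq κ'] {f : ℝ → ℝ}

namespace IsMatrixMonotone

lemma cfc_le_cfc (hf : IsMatrixMonotone f) {X Y : Matrix κ κ ℂ} (hX : X.PosDef) (hY : Y.PosDef)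
    (h : X ≤ Y) : cfc f X ≤ cfc f Y := by
  let e := (Fintype.equivFin κ).symm
  have hsub := hf _ (X.submatrix e e) (Y.submatrix e e) (hX.submatrix e.injective)
    (hY.submatrix e.injective) (Matrix.PosSemidef.submatrix h e)
  rw [cfc_submatrix_equiv f hX.isHermitian, cfc_submatrix_equiv f hY.isHermitian] at hsub
  exact (posSemidef_submatrix_equiv e).mp hsub

lemma conj_cfc_le_cfc_smul (hf : IsMatrixMonotone f) {X : Matrix κ κ ℂ} (hX : X.PosDef)
    {V : Matrix κ ι ℂ} (hV : Vᴴ * V = 1) {ε : ℝ} (hε : 0 < ε) :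
    Vᴴ * cfc f X * V ≤ cfc f ((1 + ε) • (Vᴴ * X * V)) := by
  -- `Z` dominates `X` and commutes with the projection `P` onto the range of `V`; it restricts
  -- there to `(1 + ε) Vᴴ X V`, so `f(Z)` restricts to `f((1 + ε) Vᴴ X V)`.
  obtain ⟨P, hP⟩ : ∃ P, P = V * Vᴴ := ⟨_, rfl⟩
  obtain ⟨Z, hZdef⟩ : ∃ Z, Z = (1 + ε) • (Pᴴ * X * P) + (1 + ε⁻¹) • ((1 - P)ᴴ * X * (1 - P)) :=
    ⟨_, rfl⟩
  have hPV : P * V = V := by rw [hP, Matrix.mul_assoc, hV, Matrix.mul_one]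
  have hXZ : X ≤ Z := by
    simpa only [hZdef, add_sub_cancel, conjTranspose_one, Matrix.one_mul, Matrix.mul_one] using
      conjTranspose_add_mul_mul_add_le hX.posSemidef P (1 - P) hε
  have hZ : Z.PosDef := by simpa using hX.add_posSemidef (Matrix.le_iff.mp hXZ)
  have hZV : Z * V = V * ((1 + ε) • (Vᴴ * X * V)) := by
    simp only [hZdef, Matrix.add_mul, Matrix.smul_mul, Matrix.mul_smul, Matrix.mul_assoc,
      Matrix.sub_mul, Matrix.one_mul, hPV, sub_self, Matrix.mul_zero, smul_zero, add_zero]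
    rw [hP, conjTranspose_mul, conjTranspose_conjTranspose, Matrix.mul_assoc]
  have hVXV : ((1 + ε) • (Vᴴ * X * V)).IsHermitian :=
    (isHermitian_conjTranspose_mul_mul V hX.isHermitian).smul (.all _)
  calc Vᴴ * cfc f X * V ≤ Vᴴ * cfc f Z * V :=
        conjTranspose_mul_mul_mono (hf.cfc_le_cfc hX hZ hXZ) V
    _ = cfc f ((1 + ε) • (Vᴴ * X * V)) := by
        rw [Matrix.mul_assoc, cfc_mul_eq_mul_cfc f hZ.isHermitian hVXV hZV, ← Matrix.mul_assoc,
          hV, Matrix.one_mul]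

lemma conj_cfc_add_conj_cfc_le_cfc_smul (hf : IsMatrixMonotone f) {X : Matrix κ κ ℂ}
    {Y : Matrix κ' κ' ℂ} (hX : X.PosDef) (hY : Y.PosDef) {V : Matrix κ ι ℂ} {W : Matrix κ' ι ℂ}
    (hVW : Vᴴ * V + Wᴴ * W = 1) {ε : ℝ} (hε : 0 < ε) :
    Vᴴ * cfc f X * V + Wᴴ * cfc f Y * W ≤ cfc f ((1 + ε) • (Vᴴ * X * V + Wᴴ * Y * W)) := by
  have hiso : (fromRows V W)ᴴ * fromRows V W = 1 := by
    rw [conjTranspose_fromRows_eq_fromCols_conjTranspose, fromCols_mul_fromRows, hVW]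
  have h := hf.conj_cfc_le_cfc_smul (posDef_fromBlocks_diagonal hX hY) hiso hε
  rw [cfc_fromBlocks_diagonal f hX.isHermitian hY.isHermitian] at h
  simpa only [conjTranspose_fromRows_eq_fromCols_conjTranspose, fromCols_mul_fromBlocks,
    fromCols_mul_fromRows, Matrix.mul_zero, add_zero, zero_add] using h

lemma mul_add_mul_le_map_mul (hf : IsMatrixMonotone f) {x y a b ε : ℝ} (hx : 0 < x) (hy : 0 < y)
    (ha : 0 ≤ a) (hb : 0 ≤ b) (hab : a + b = 1) (hε : 0 < ε) :
    a * f x + b * f y ≤ f ((1 + ε) * (a * x + b * y)) := by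
  have hpos {z : ℝ} (hz : 0 < z) : (z • (1 : Matrix Unit Unit ℂ)).PosDef := PosDef.one.smul hz
  have hcfc (z : ℝ) : cfc f (z • (1 : Matrix Unit Unit ℂ)) = f z • 1 := by
    simpa only [Algebra.algebraMap_eq_smul_one] using
      cfc_algebraMap (A := Matrix Unit Unit ℂ) z f
  have hconj {c : ℝ} (hc : 0 ≤ c) (z : ℝ) :
      (√c • (1 : Matrix Unit Unit ℂ))ᴴ * (z • 1) * (√c • 1) = (c * z) • 1 := by
    rw [conjTranspose_smul, conjTranspose_one, star_trivial, smul_mul_smul_comm,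
      smul_mul_smul_comm, Matrix.one_mul, Matrix.one_mul, mul_right_comm, Real.mul_self_sqrt hc]
  have hone : (√a • (1 : Matrix Unit Unit ℂ))ᴴ * √a • 1 + (√b • 1)ᴴ * √b • 1 = 1 := by
    simpa [← add_smul, hab] using congrArg₂ (· + ·) (hconj ha 1) (hconj hb 1)
  have h := hf.conj_cfc_add_conj_cfc_le_cfc_smul (hpos hx) (hpos hy) hone hε
  rw [hcfc, hcfc, hconj ha, hconj hb, hconj ha, hconj hb, ← add_smul, ← add_smul, smul_smul,
    hcfc, Matrix.le_iff, ← sub_smul] at h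
  simpa [-Complex.ofReal_sub, -Complex.ofReal_add, -Complex.ofReal_mul] using
    h.diag_nonneg (i := ())

/-- With weights `1 - 2ε` and `2ε`, the mean of `(1 + ε) x` and `x / 2` is strictly below `x`, which
leaves room for the loss in `mul_add_mul_le_map_mul`. -/
lemma tendsto_map_one_add_mul (hf : IsMatrixMonotone f) {x : ℝ} (hx : 0 < x) :
    Tendsto (fun ε => f ((1 + ε) * x)) (𝓝[>] 0) (𝓝 (f x)) := by
  have hlower : ∀ ε : ℝ, 0 < ε → f x ≤ f ((1 + ε) * x) := fun ε hε => by
    simpa using hf.mul_add_mul_le_map_mul hx hx zero_le_one le_rfl (add_zero 1) hε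
  have hupper : ∀ ε : ℝ, 0 < ε → ε < 1 / 2 →
      f ((1 + ε) * x) ≤ (f x - 2 * ε * f (x / 2)) / (1 - 2 * ε) := by
    intro ε hε hε'
    have hlt : 0 < 1 - 2 * ε ^ 2 := by nlinarith
    have hgap : 0 < (1 - 2 * ε ^ 2)⁻¹ - 1 := sub_pos.mpr <| (one_lt_inv₀ hlt).mpr <| by
      linarith [pow_pos hε 2]
    have h := hf.mul_add_mul_le_map_mul (x := (1 + ε) * x) (y := x / 2) (a := 1 - 2 * ε)
      (b := 2 * ε) (by positivity) (by positivity) (by linarith) (by linarith) (by ring) hgap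
    have hmean : (1 + ((1 - 2 * ε ^ 2)⁻¹ - 1)) *
        ((1 - 2 * ε) * ((1 + ε) * x) + 2 * ε * (x / 2)) = x := by
      field_simp
      ring
    rw [hmean] at h
    rw [le_div_iff₀ (by linarith)]
    linarith
  have hlim : Tendsto (fun ε : ℝ => (f x - 2 * ε * f (x / 2)) / (1 - 2 * ε)) (𝓝[>] 0)
      (𝓝 (f x)) := by
    have hcont : ContinuousAt (fun ε : ℝ => (f x - 2 * ε * f (x / 2)) / (1 - 2 * ε)) 0 :=
      ContinuousAt.div (by fun_prop) (by fun_prop) (by simp)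
    simpa using hcont.tendsto.mono_left nhdsWithin_le_nhds
  refine tendsto_of_tendsto_of_tendsto_of_le_of_le' tendsto_const_nhds hlim
    (eventually_nhdsWithin_of_forall hlower) ?_
  filter_upwards [Ioo_mem_nhdsGT (show (0 : ℝ) < 1 / 2 by norm_num)] with ε hε
  exact hupper ε hε.1 hε.2

lemma tendsto_cfc_one_add_smul (hf : IsMatrixMonotone f) {Y : Matrix ι ι ℂ} (hY : Y.PosDef) :
    Tendsto (fun ε : ℝ => cfc f ((1 + ε) • Y)) (𝓝[>] 0) (𝓝 (cfc f Y)) := by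
  have hcfc (ε : ℝ) : cfc f ((1 + ε) • Y) = cfc (fun x => f ((1 + ε) * x)) Y :=
    (cfc_comp_smul (1 + ε) f Y ((Y.finite_real_spectrum.image _).continuousOn _)
      hY.isHermitian).symm
  simp only [hcfc]
  exact tendsto_cfc_of_tendsto_on_spectrum fun x hx =>
    hf.tendsto_map_one_add_mul (hY.isStrictlyPositive.spectrum_pos hx)

open scoped Matrix.Norms.L2Operator in
theorem conj_cfc_add_conj_cfc_le (hf : IsMatrixMonotone f) {X : Matrix κ κ ℂ}
    {Y : Matrix κ' κ' ℂ} (hX : X.PosDef) (hY : Y.PosDef) {V : Matrix κ ι ℂ} {W : Matrix κ' ι ℂ}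
    (hVW : Vᴴ * V + Wᴴ * W = 1) (hpos : (Vᴴ * X * V + Wᴴ * Y * W).PosDef) :
    Vᴴ * cfc f X * V + Wᴴ * cfc f Y * W ≤ cfc f (Vᴴ * X * V + Wᴴ * Y * W) :=
  ge_of_tendsto (hf.tendsto_cfc_one_add_smul hpos) <| eventually_nhdsWithin_of_forall fun _ hε =>
    hf.conj_cfc_add_conj_cfc_le_cfc_smul hX hY hVW hε

end IsMatrixMonotone

end MatrixMonotone

section Perspective

variable {ι : Type*} [Fintype ι] [DecidableEq ι] {f : ℝ → ℝ} {L R L₁ L₂ R₁ R₂ : Matrix ι ι ℂ}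

lemma isUnit_sqrt (hR : R.PosDef) : IsUnit (CFC.sqrt R) :=
  CFC.isUnit_sqrt_iff_isStrictlyPositive.mpr hR.isStrictlyPositive

lemma sqrt_smul {A : Type*} [PartialOrder A] [NonUnitalRing A] [TopologicalSpace A] [StarRing A]
    [Module ℝ A] [SMulCommClass ℝ A A] [IsScalarTower ℝ A A] [StarOrderedRing A]
    [NonUnitalContinuousFunctionalCalculus ℝ A IsSelfAdjoint] [NonnegSpectrumClass ℝ A]
    [IsSemitopologicalRing A] [T2Space A] [PosSMulMono ℝ A] {a : A} (ha : 0 ≤ a) {t : ℝ}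
    (ht : 0 ≤ t) : CFC.sqrt (t • a) = √t • CFC.sqrt a := by
  refine CFC.sqrt_unique ?_ (smul_nonneg (Real.sqrt_nonneg t) (CFC.sqrt_nonneg a))
  rw [smul_mul_smul_comm, Real.mul_self_sqrt ht, CFC.sqrt_mul_sqrt_self a ha]

lemma conjTranspose_sqrt (R : Matrix ι ι ℂ) : (CFC.sqrt R)ᴴ = CFC.sqrt R :=
  (CFC.sqrt_nonneg R).isSelfAdjoint

lemma posDef_inv_sqrt_mul_mul_inv_sqrt (hL : L.PosDef) (hR : R.PosDef) :
    ((CFC.sqrt R)⁻¹ * L * (CFC.sqrt R)⁻¹).PosDef := by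
  rw [← isStrictlyPositive_iff_posDef]
  exact hL.isStrictlyPositive.conjugate_of_isUnit_of_isSelfAdjoint _ _
    ((isUnit_nonsing_inv_iff).mpr (isUnit_sqrt hR)) (IsHermitian.inv (conjTranspose_sqrt R))

lemma conj_sqrt_mul_inv_sqrt (R T M : Matrix ι ι ℂ) :
    (CFC.sqrt R * (CFC.sqrt T)⁻¹)ᴴ * M * (CFC.sqrt R * (CFC.sqrt T)⁻¹) =
      (CFC.sqrt T)⁻¹ * (CFC.sqrt R * M * CFC.sqrt R) * (CFC.sqrt T)⁻¹ := by
  rw [conjTranspose_mul, conjTranspose_sqrt, conjTranspose_nonsing_inv, conjTranspose_sqrt]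
  simp only [Matrix.mul_assoc]

lemma sqrt_mul_inv_sqrt_conj_mul_sqrt (L : Matrix ι ι ℂ) (hR : R.PosDef) :
    CFC.sqrt R * ((CFC.sqrt R)⁻¹ * L * (CFC.sqrt R)⁻¹) * CFC.sqrt R = L := by
  have := (isUnit_sqrt hR).invertible
  simp [Matrix.mul_assoc]

/-- The operator perspective `R^{1/2} f(R^{-1/2} L R^{-1/2}) R^{1/2}` of `f`. When `L` and `R`
commute it is `f(L R⁻¹) R`. -/
noncomputable def perspective (f : ℝ → ℝ) (L R : Matrix ι ι ℂ) : Matrix ι ι ℂ :=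
  CFC.sqrt R * cfc f ((CFC.sqrt R)⁻¹ * L * (CFC.sqrt R)⁻¹) * CFC.sqrt R

lemma isHermitian_perspective (f : ℝ → ℝ) (L R : Matrix ι ι ℂ) :
    (perspective f L R).IsHermitian := by
  have hcfc : (cfc f ((CFC.sqrt R)⁻¹ * L * (CFC.sqrt R)⁻¹)).IsHermitian := cfc_predicate f _
  simpa only [perspective, conjTranspose_sqrt] using
    isHermitian_conjTranspose_mul_mul (CFC.sqrt R) hcfc

lemma perspective_smul_smul (f : ℝ → ℝ) (L : Matrix ι ι ℂ) (hR : R.PosDef) {t : ℝ} (ht : 0 < t) :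
    perspective f (t • L) (t • R) = t • perspective f L R := by
  have ht' : √t ≠ 0 := Real.sqrt_ne_zero'.mpr ht
  have hinv : (√t • CFC.sqrt R)⁻¹ = (√t)⁻¹ • (CFC.sqrt R)⁻¹ := by
    refine inv_eq_right_inv ?_
    rw [smul_mul_smul_comm, mul_inv_cancel₀ ht', one_smul,
      mul_nonsing_inv _ ((isUnit_iff_isUnit_det _).mp (isUnit_sqrt hR))]
  have harg : (√t)⁻¹ * t * (√t)⁻¹ = 1 := by
    field_simp
    exact (Real.sq_sqrt ht.le).symm
  rw [perspective, sqrt_smul hR.posSemidef.nonneg ht.le, hinv, smul_mul_smul_comm,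
    smul_mul_smul_comm, harg, one_smul, Matrix.smul_mul, smul_mul_smul_comm,
    Real.mul_self_sqrt ht.le, perspective]

namespace IsMatrixMonotone

lemma perspective_add_le (hf : IsMatrixMonotone f) (hL₁ : L₁.PosDef) (hR₁ : R₁.PosDef)
    (hL₂ : L₂.PosDef) (hR₂ : R₂.PosDef) :
    perspective f L₁ R₁ + perspective f L₂ R₂ ≤ perspective f (L₁ + L₂) (R₁ + R₂) := by
  have hR := hR₁.add hR₂
  obtain ⟨S, hS⟩ : ∃ S, S = CFC.sqrt (R₁ + R₂) := ⟨_, rfl⟩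
  have := (hS ▸ isUnit_sqrt hR : IsUnit S).invertible
  have hSS : S * S = R₁ + R₂ := hS ▸ CFC.sqrt_mul_sqrt_self _ hR.posSemidef.nonneg
  have hgram {R : Matrix ι ι ℂ} (hR : R.PosDef) :
      (CFC.sqrt R * S⁻¹)ᴴ * (CFC.sqrt R * S⁻¹) = S⁻¹ * R * S⁻¹ := by
    simpa [hS, CFC.sqrt_mul_sqrt_self R hR.posSemidef.nonneg] using
      conj_sqrt_mul_inv_sqrt R (R₁ + R₂) 1
  have hone : (CFC.sqrt R₁ * S⁻¹)ᴴ * (CFC.sqrt R₁ * S⁻¹) +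
      (CFC.sqrt R₂ * S⁻¹)ᴴ * (CFC.sqrt R₂ * S⁻¹) = 1 := by
    rw [hgram hR₁, hgram hR₂, ← Matrix.add_mul, ← Matrix.mul_add, ← hSS]
    simp
  have hmean : (CFC.sqrt R₁ * S⁻¹)ᴴ * ((CFC.sqrt R₁)⁻¹ * L₁ * (CFC.sqrt R₁)⁻¹) *
        (CFC.sqrt R₁ * S⁻¹) + (CFC.sqrt R₂ * S⁻¹)ᴴ * ((CFC.sqrt R₂)⁻¹ * L₂ * (CFC.sqrt R₂)⁻¹) *
        (CFC.sqrt R₂ * S⁻¹) = S⁻¹ * (L₁ + L₂) * S⁻¹ := by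
    rw [hS, conj_sqrt_mul_inv_sqrt, conj_sqrt_mul_inv_sqrt,
      sqrt_mul_inv_sqrt_conj_mul_sqrt L₁ hR₁, sqrt_mul_inv_sqrt_conj_mul_sqrt L₂ hR₂,
      Matrix.mul_add, Matrix.add_mul]
  have hjensen := hf.conj_cfc_add_conj_cfc_le (posDef_inv_sqrt_mul_mul_inv_sqrt hL₁ hR₁)
    (posDef_inv_sqrt_mul_mul_inv_sqrt hL₂ hR₂) hone
    (by rw [hmean, hS]; exact posDef_inv_sqrt_mul_mul_inv_sqrt (hL₁.add hL₂) hR)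
  rw [hmean, hS, conj_sqrt_mul_inv_sqrt, conj_sqrt_mul_inv_sqrt, ← Matrix.add_mul,
    ← Matrix.mul_add, ← hS] at hjensen
  have hSherm : Sᴴ = S := by rw [hS, conjTranspose_sqrt]
  simpa [perspective, hSherm, ← hS, Matrix.mul_assoc] using conjTranspose_mul_mul_mono hjensen S

theorem concaveOn_perspective (hf : IsMatrixMonotone f) :
    ConcaveOn ℝ ({L : Matrix ι ι ℂ | L.PosDef} ×ˢ {R : Matrix ι ι ℂ | R.PosDef})
      (fun p => perspective f p.1 p.2) := by
  refine concaveOn_iff_forall_pos.mpr ⟨convex_posDef.prod convex_posDef, ?_⟩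
  rintro ⟨L₁, R₁⟩ ⟨hL₁, hR₁⟩ ⟨L₂, R₂⟩ ⟨hL₂, hR₂⟩ a b ha hb -
  calc a • perspective f L₁ R₁ + b • perspective f L₂ R₂
      = perspective f (a • L₁) (a • R₁) + perspective f (b • L₂) (b • R₂) := by
        rw [perspective_smul_smul f L₁ hR₁ ha, perspective_smul_smul f L₂ hR₂ hb]
    _ ≤ perspective f (a • L₁ + b • L₂) (a • R₁ + b • R₂) :=
        hf.perspective_add_le (hL₁.smul ha) (hR₁.smul ha) (hL₂.smul hb) (hR₂.smul hb)

end IsMatrixMonotone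

end Perspective

section QuasiEntropy

variable {n : ℕ} {f : ℝ → ℝ}

lemma hsInner_eq_star_vec_dotProduct_vec (A B : Matrix (Fin n) (Fin n) ℂ) :
    hsInner A B = star (vec Aᵀ) ⬝ᵥ vec Bᵀ := by
  rw [star_vec_dotProduct_vec, hsInner, ← trace_transpose, transpose_mul, trace_mul_comm]
  rfl

lemma vec_transpose_toLin_stdBasis (M : Matrix (Fin n × Fin n) (Fin n × Fin n) ℂ)
    (B : Matrix (Fin n) (Fin n) ℂ) :
    vec (toLin (stdBasis ℂ (Fin n) (Fin n)) (stdBasis ℂ (Fin n) (Fin n)) M B)ᵀ = M *ᵥ vec Bᵀ := by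
  have hrepr (C : Matrix (Fin n) (Fin n) ℂ) : vec Cᵀ = (stdBasis ℂ (Fin n) (Fin n)).repr C := by
    ext ⟨i, j⟩
    simp [stdBasis]
  rw [hrepr, hrepr, repr_toLin]

lemma opMatrix_modularOp (ρ₁ ρ₂ : Matrix (Fin n) (Fin n) ℂ) :
    opMatrix (modularOp ρ₁ ρ₂) = ρ₁ ⊗ₖ ρ₂⁻¹ᵀ := by
  ext ⟨i, j⟩ ⟨k, l⟩
  exact opMatrix_modularOp_apply ρ₁ ρ₂ i j k l

lemma sqrt_one_kronecker_transpose {ρ : Matrix (Fin n) (Fin n) ℂ} (hρ : ρ.PosSemidef) :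
    CFC.sqrt ((1 : Matrix (Fin n) (Fin n) ℂ) ⊗ₖ ρᵀ) = 1 ⊗ₖ (CFC.sqrt ρ)ᵀ := by
  refine CFC.sqrt_unique ?_
    (PosSemidef.one.kronecker (nonneg_iff_posSemidef.mp (CFC.sqrt_nonneg ρ)).transpose).nonneg
  rw [← mul_kronecker_mul, Matrix.one_mul, ← transpose_mul,
    CFC.sqrt_mul_sqrt_self ρ hρ.nonneg]

/-- `vec` is indexed by (column, row) but the matrix units by (row, column), hence the transposes:
in the coordinates `vec Bᵀ`, left multiplication by `ρ₁` is `ρ₁ ⊗ₖ 1` and right multiplication by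
`ρ₂` is `1 ⊗ₖ ρ₂ᵀ`. -/
theorem quasiEntropy_eq_dotProduct_perspective (f : ℝ → ℝ) {ρ₁ ρ₂ : Matrix (Fin n) (Fin n) ℂ}
    (hρ₂ : ρ₂.PosDef) (A B : Matrix (Fin n) (Fin n) ℂ) :
    quasiEntropy f ρ₁ ρ₂ A B =
      star (vec Aᵀ) ⬝ᵥ perspective f (ρ₁ ⊗ₖ 1) (1 ⊗ₖ ρ₂ᵀ) *ᵥ vec Bᵀ := by
  have hmodular : (1 ⊗ₖ (CFC.sqrt ρ₂)ᵀ)⁻¹ * (ρ₁ ⊗ₖ 1) * (1 ⊗ₖ (CFC.sqrt ρ₂)ᵀ)⁻¹ =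
      opMatrix (modularOp ρ₁ ρ₂) := by
    rw [opMatrix_modularOp, inv_kronecker, inv_one, ← mul_kronecker_mul, ← mul_kronecker_mul,
      Matrix.one_mul, Matrix.mul_one, Matrix.mul_one, ← Matrix.mul_inv_rev, ← transpose_mul,
      CFC.sqrt_mul_sqrt_self ρ₂ hρ₂.posSemidef.nonneg, transpose_nonsing_inv]
  have hvec (C : Matrix (Fin n) (Fin n) ℂ) :
      vec (C * CFC.sqrt ρ₂)ᵀ = (1 ⊗ₖ (CFC.sqrt ρ₂)ᵀ) *ᵥ vec Cᵀ := by
    rw [transpose_mul, vec_mul_eq_mulVec]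
  have hherm : ((1 : Matrix (Fin n) (Fin n) ℂ) ⊗ₖ (CFC.sqrt ρ₂)ᵀ)ᴴ = 1 ⊗ₖ (CFC.sqrt ρ₂)ᵀ := by
    rw [← sqrt_one_kronecker_transpose hρ₂.posSemidef, conjTranspose_sqrt]
  rw [quasiEntropy, hsInner_eq_star_vec_dotProduct_vec, opFun, vec_transpose_toLin_stdBasis, hvec,
    hvec, perspective, sqrt_one_kronecker_transpose hρ₂.posSemidef, hmodular, star_mulVec, hherm,
    ← dotProduct_mulVec, mulVec_mulVec, mulVec_mulVec]

lemma quasiEntropy_self_im (f : ℝ → ℝ) {ρ₁ ρ₂ : Matrix (Fin n) (Fin n) ℂ} (hρ₂ : ρ₂.PosDef)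
    (A : Matrix (Fin n) (Fin n) ℂ) : (quasiEntropy f ρ₁ ρ₂ A A).im = 0 := by
  rw [quasiEntropy_eq_dotProduct_perspective f hρ₂]
  exact (isHermitian_perspective f _ _).im_star_dotProduct_mulVec_self _

theorem IsMatrixMonotone.concaveOn_quasiEntropy (hf : IsMatrixMonotone f)
    (A : Matrix (Fin n) (Fin n) ℂ) :
    ConcaveOn ℝ ({ρ | ρ.PosDef} ×ˢ {ρ | ρ.PosDef}) (fun p => (quasiEntropy f p.1 p.2 A A).re) := by
  refine ⟨convex_posDef.prod convex_posDef, ?_⟩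
  rintro ⟨ρ₁, ρ₂⟩ ⟨hρ₁, hρ₂⟩ ⟨σ₁, σ₂⟩ ⟨hσ₁, hσ₂⟩ a b ha hb hab
  have hcomb : (a • ρ₂ + b • σ₂).PosDef := convex_posDef hρ₂ hσ₂ ha hb hab
  have hleft : a • (ρ₁ ⊗ₖ (1 : Matrix (Fin n) (Fin n) ℂ)) + b • (σ₁ ⊗ₖ 1) =
      (a • ρ₁ + b • σ₁) ⊗ₖ 1 := by
    rw [add_kronecker, smul_kronecker, smul_kronecker]
  have hright : a • ((1 : Matrix (Fin n) (Fin n) ℂ) ⊗ₖ ρ₂ᵀ) + b • (1 ⊗ₖ σ₂ᵀ) =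
      1 ⊗ₖ (a • ρ₂ + b • σ₂)ᵀ := by
    rw [transpose_add, transpose_smul, transpose_smul, kronecker_add, kronecker_smul,
      kronecker_smul]
  have hperspective := hf.concaveOn_perspective.2 (x := (ρ₁ ⊗ₖ 1, 1 ⊗ₖ ρ₂ᵀ))
    ⟨hρ₁.kronecker .one, PosDef.one.kronecker hρ₂.transpose⟩ (y := (σ₁ ⊗ₖ 1, 1 ⊗ₖ σ₂ᵀ))
    ⟨hσ₁.kronecker .one, PosDef.one.kronecker hσ₂.transpose⟩ ha hb hab
  have hform := (Matrix.le_iff.mp hperspective).re_dotProduct_nonneg (vec Aᵀ)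
  simp only [Prod.smul_mk, Prod.mk_add_mk, hleft, hright, sub_mulVec, add_mulVec, smul_mulVec,
    dotProduct_sub, dotProduct_add, dotProduct_smul,
    ← quasiEntropy_eq_dotProduct_perspective f hρ₂, ← quasiEntropy_eq_dotProduct_perspective f hσ₂,
    ← quasiEntropy_eq_dotProduct_perspective f hcomb] at hform
  simpa using hform

lemma convexOn_norm_trace_mul_sq {𝕜 ι : Type*} [RCLike 𝕜] [Fintype ι] (A : Matrix ι ι 𝕜) :
    ConvexOn ℝ Set.univ fun ρ : Matrix ι ι 𝕜 => ‖(ρ * A).trace‖ ^ 2 :=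
  (convexOn_univ_norm.comp_linearMap
    (traceLinearMap ι ℝ 𝕜 ∘ₗ LinearMap.mulRight ℝ A)).pow (fun _ _ => norm_nonneg _) 2

lemma qCov_self (f : ℝ → ℝ) {ρ : Matrix (Fin n) (Fin n) ℂ} (hρ : ρ.IsHermitian)
    (A : Matrix (Fin n) (Fin n) ℂ) :
    qCov f ρ A A = quasiEntropy f ρ ρ A A - (‖(ρ * A).trace‖ ^ 2 : ℝ) := by
  have htrace : (ρ * Aᴴ).trace = star (ρ * A).trace := by
    rw [← trace_conjTranspose, conjTranspose_mul, hρ.eq, trace_mul_comm]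
  rw [qCov, htrace]
  simp [Complex.conj_mul']

end QuasiEntropy

end QuasiEntropy

theorem mainTheorem6_general (f : ℝ → ℝ) (hf : QuasiEntropy.IsMatrixMonotone f) (n : ℕ)
    (A : Matrix (Fin n) (Fin n) ℂ) :
    (∀ ρ : Matrix (Fin n) (Fin n) ℂ, ρ.PosDef → (QuasiEntropy.qCov f ρ A A).im = 0) ∧
    ConcaveOn ℝ {ρ : Matrix (Fin n) (Fin n) ℂ | ρ.PosDef}
      (fun ρ => (QuasiEntropy.qCov f ρ A A).re) := by
  refine ⟨fun ρ hρ => ?_, ?_⟩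
  · rw [QuasiEntropy.qCov_self f hρ.isHermitian, Complex.sub_im, Complex.ofReal_im, sub_zero,
      QuasiEntropy.quasiEntropy_self_im f hρ]
  · have hquasi : ConcaveOn ℝ {ρ : Matrix (Fin n) (Fin n) ℂ | ρ.PosDef}
        (fun ρ => (QuasiEntropy.quasiEntropy f ρ ρ A A).re) := by
      simpa [Set.preimage, Function.comp_def] using (hf.concaveOn_quasiEntropy A).comp_linearMap
        (LinearMap.prod LinearMap.id LinearMap.id)
    have htrace := (QuasiEntropy.convexOn_norm_trace_mul_sq A).subset (Set.subset_univ _)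
      QuasiEntropy.convex_posDef
    refine (hquasi.sub htrace).congr fun ρ hρ => ?_
    rw [QuasiEntropy.qCov_self f hρ.isHermitian, Complex.sub_re, Complex.ofReal_re, Pi.sub_apply]

theorem mainTheorem6 (f : ℝ → ℝ) (hf : QuasiEntropy.IsStandardMatrixMonotone f) (n : ℕ)
    (A : Matrix (Fin n) (Fin n) ℂ) (hA : A.IsHermitian) :
    (∀ ρ : Matrix (Fin n) (Fin n) ℂ, ρ.PosDef → (QuasiEntropy.qCov f ρ A A).im = 0) ∧
    ConcaveOn ℝ {ρ : Matrix (Fin n) (Fin n) ℂ | ρ.PosDef}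
      (fun ρ => (QuasiEntropy.qCov f ρ A A).re) :=
  mainTheorem6_general f hf.monotone n A
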